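/- Let $m\ge n\ge 1$ be integers, and let $\mathbf m\times\mathbf n$ be the set $\{1,\dots,m\}\times\{1,\dots,n\}$ with the componentwise order. For a partition $\lambda=(\lambda_1\ge\lambda_2\ge\cdots\ge\lambda_\ell>0)$ of $mn$, let $\mathrm{SCP}_{\mathbf m\times\mathbf n,\lambda}$ be the set of semi-ordered chain partitions of $\mathbf m\times\mathbf n$ of type $\lambda$, that is, of sequences $(C_1,\dots,C_\ell)$ of pairwise disjoint chains with union $\mathbf m\times\mathbf n$ and $|C_i|=\lambda_i$ for $1\le i\le\ell$ (so parts of equal size are also ordered). Suppose that $$\lambda_i=m+n-2i+1\qquad\text{for } 1\le i\le n-1,$$ and for $1\le k\le m-n+1$ let $\alpha_k$ be the number of parts equal to $k$ in $\lambda^{\langle n\rangle}=(\lambda_n,\lambda_{n+1},\dots,\lambda_\ell)$. Then $$|\mathrm{SCP}_{\mathbf m\times\mathbf n,\lambda}|=(n-1)!\sum_{(a_{kj})}\ \prod_{j=1}^{n}\Bigl(\sum_{k=1}^{m-n+1}k\,a_{kj}\Bigr)!\ \prod_{k=1}^{m-n+1}\binom{\alpha_k}{a_{k1},\dots,a_{kn}}\Bigl(\frac1{k!}\Bigr)^{\alpha_k},$$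 where the sum is over all arrays $(a_{kj})_{1\le k\le m-n+1,\,1\le j\le n}$ of non-negative integers with $a_{k1}+\cdots+a_{kn}=\alpha_k$ for every $1\le k\le m-n+1$. -/

import Mathlib

/-- The parts `λ₁ ≥ λ₂ ≥ ⋯ ≥ λ_ℓ` of a partition, listed in weakly decreasing order
(`λ_i` is the entry with index `i - 1`). -/
def partList {N : ℕ} (lam : N.Partition) : List ℕ :=
  lam.parts.sort (· ≥ ·)

/-- The sequence `λ^⟨k⟩ = (λ_k, …, λ_ℓ)` obtained from `λ` by removing its first `k - 1` parts. -/
def truncatedParts {N : ℕ} (lam : N.Partition) (k : ℕ) : List ℕ :=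
  (partList lam).drop (k - 1)

/-- A semi-ordered chain partition of a poset `P` with `ℓ` parts: a sequence `(C₁, …, C_ℓ)` of
nonempty, pairwise disjoint chains which cover `P`, arranged by weakly decreasing size.
(The order among parts of equal size is recorded by the sequence.) -/
structure IsSemiOrderedChainPartition {P : Type*} [PartialOrder P] {ℓ : ℕ}
    (C : Fin ℓ → Finset P) : Prop where
  nonempty : ∀ i, (C i).Nonempty
  isChain : ∀ i, IsChain (· ≤ ·) (C i : Set P)
  disjoint : ∀ i j, i ≠ j → Disjoint (C i) (C j)
  cover : ∀ x : P, ∃ i, x ∈ C i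
  antitone_card : Antitone fun i => (C i).card

/-- The set of semi-ordered chain partitions of `P` of type `λ`: those whose sequence of part
sizes is `(λ₁, …, λ_ℓ)`. -/
def SCP (P : Type*) [PartialOrder P] {N : ℕ} (lam : N.Partition) :
    Set (Fin (partList lam).length → Finset P) :=
  {C | IsSemiOrderedChainPartition C ∧ ∀ i, (C i).card = (partList lam).get i}

/-! Grade the grid by rank, the sum of the 0-based coordinates. A chain meets each rank at most
once, and rank `r` has one element in each row from `r + 1 - m` to `min r (n - 1)`. The long chain
of index `i` must occupy exactly the ranks `i, …, m + n - 2 - i`, because earlier long chains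
already fill the ranks outside this window (`image_rank_long`). So the long chains leave free one
element in each rank `r` with `n - 1 ≤ r < m`, and none elsewhere; the short chains partition these
free elements.

Two rigidity facts give a normal form. Rows of free elements weakly decrease with the rank, by
pigeonhole (`short_row_le`), while rows weakly increase along a chain, so each short chain lies in a
single row. Long chains cannot cross (`long_row_lt`), so their vertical order is one permutation,
visible at rank `n - 2`. A configuration thus amounts to a permutation `pos`, a row `f k` for each
short chain, and a word `w` naming the short chain at each middle rank, with prescribed letter
counts and `f ∘ w` antitone; every such triple occurs (`isLongShortChains_chainsOf`,
`exists_eq_chainsOf`, `chainsOf_inj`).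

For fixed `f` the number of words is `∏ⱼ (∑_{f k = j} μ k)! / ∏ₖ (μ k)!` (`card_antitone_comp_mul`).
Grouping the `f` by how many short chains of each size lie in each row produces the arrays and their
multinomial coefficients (`card_jointCard_eq`). -/

/-! ### Rows of the long chains, rank by rank -/

/-- The indices of the long chains that meet the rank `r`. -/
def activeLong (m n r : ℕ) : Finset (Fin (n - 1)) :=
  Finset.univ.filter fun j => j.val ≤ r ∧ j.val + r + 2 ≤ m + n

theorem mem_activeLong {m n r : ℕ} {j : Fin (n - 1)} :
    j ∈ activeLong m n r ↔ j.val ≤ r ∧ j.val + r + 2 ≤ m + n := by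
  simp [activeLong]

theorem card_activeLong (m n r : ℕ) :
    (activeLong m n r).card = min (n - 1) (min (r + 1) (m + n - 1 - r)) := by
  have h : (activeLong m n r).image Fin.val
      = Finset.range (min (n - 1) (min (r + 1) (m + n - 1 - r))) := by
    ext k
    simp only [Finset.mem_image, mem_activeLong, Finset.mem_range]
    constructor
    · rintro ⟨j, hj, rfl⟩
      have := j.2
      omega
    · intro hk
      exact ⟨⟨k, by omega⟩, by simp only; omega, rfl⟩
  rw [← Finset.card_image_of_injective _ Fin.val_injective, h, Finset.card_range]

/-- The long chains that meet the rank `r` and come before the `i`-th one in the order given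
by `pos`. -/
def activeBefore (m n : ℕ) (pos : Fin (n - 1) → ℕ) (r : ℕ) (i : Fin (n - 1)) :
    Finset (Fin (n - 1)) :=
  (activeLong m n r).filter fun j => pos j < pos i

theorem mem_activeBefore {m n r : ℕ} {pos : Fin (n - 1) → ℕ} {i j : Fin (n - 1)} :
    j ∈ activeBefore m n pos r i ↔ (j.val ≤ r ∧ j.val + r + 2 ≤ m + n) ∧ pos j < pos i := by
  simp [activeBefore, mem_activeLong]

theorem card_activeBefore_lt {m n r : ℕ} {pos : Fin (n - 1) → ℕ} {i : Fin (n - 1)}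
    (hi : i ∈ activeLong m n r) :
    (activeBefore m n pos r i).card < (activeLong m n r).card := by
  apply Finset.card_lt_card
  unfold activeBefore
  rw [Finset.ssubset_iff_of_subset (Finset.filter_subset _ _)]
  exact ⟨i, hi, by simp⟩

theorem card_activeBefore_lt_of_pos_lt {m n r : ℕ} {pos : Fin (n - 1) → ℕ} {i j : Fin (n - 1)}
    (hi : i ∈ activeLong m n r) (h : pos i < pos j) :
    (activeBefore m n pos r i).card < (activeBefore m n pos r j).card := by
  apply Finset.card_lt_card
  rw [Finset.ssubset_iff_of_subset]
  · rw [mem_activeLong] at hi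
    exact ⟨i, by rw [mem_activeBefore]; exact ⟨hi, h⟩, by simp [mem_activeBefore]⟩
  · intro k
    simp only [mem_activeBefore]
    omega

/-- The row in which the `i`-th long chain meets the rank `r`, when the long chains are ordered
by `pos` and the elements outside the long chains are in the rows `d`. -/
def pathRow (m n : ℕ) (pos : Fin (n - 1) → ℕ) (d : ℕ → ℕ) (r : ℕ) (i : Fin (n - 1)) : ℕ :=
  -- The term `r + 1 - m` is the lowest row of rank `r`; the indicator skips the row of the free
  -- element, which exists only for `n - 1 ≤ r < m`.
  (r + 1 - m) + (activeBefore m n pos r i).card +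
    if n - 1 ≤ r ∧ r < m ∧ d r ≤ (activeBefore m n pos r i).card then 1 else 0

section pathRow

variable {m n : ℕ} {pos : Fin (n - 1) → ℕ} {d : ℕ → ℕ} {r : ℕ} {i j : Fin (n - 1)}

theorem pathRow_bounds (hmn : n ≤ m) (hi : i ∈ activeLong m n r) :
    pathRow m n pos d r i ≤ r ∧ r < m + pathRow m n pos d r i ∧ pathRow m n pos d r i < n := by
  have h1 := card_activeBefore_lt (pos := pos) hi
  rw [card_activeLong] at h1
  have := i.2
  rw [mem_activeLong] at hi
  unfold pathRow
  split_ifs <;> omega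

theorem pathRow_lt_of_pos_lt (hi : i ∈ activeLong m n r) (h : pos i < pos j) :
    pathRow m n pos d r i < pathRow m n pos d r j := by
  have h1 := card_activeBefore_lt_of_pos_lt hi h
  unfold pathRow
  split_ifs <;> omega

theorem pathRow_injOn (hpos : Function.Injective pos) (hi : i ∈ activeLong m n r)
    (hj : j ∈ activeLong m n r) (h : pathRow m n pos d r i = pathRow m n pos d r j) : i = j := by
  by_contra hne
  rcases lt_or_gt_of_ne (hpos.ne hne) with h1 | h1
  · exact absurd h (pathRow_lt_of_pos_lt hi h1).ne
  · exact absurd h (pathRow_lt_of_pos_lt hj h1).ne'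

theorem pathRow_ne (h1 : n - 1 ≤ r) (h2 : r < m) : pathRow m n pos d r i ≠ d r := by
  unfold pathRow
  split_ifs <;> omega

/-- In the growing ranks at most one new chain enters below; in the middle the active set is
constant and a decreasing `d` can only switch the indicator on; in the shrinking ranks the lowest
row rises by one and at most one chain below ends. -/
theorem pathRow_succ (hmn : n ≤ m) (hd : ∀ r, n - 1 ≤ r → r + 1 < m → d (r + 1) ≤ d r) :
    pathRow m n pos d r i ≤ pathRow m n pos d (r + 1) i ∧
      pathRow m n pos d (r + 1) i ≤ pathRow m n pos d r i + 1 := by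
  have hi := i.2
  rcases lt_or_ge (r + 1) (n - 1) with h1 | h1
  · have e1 : activeBefore m n pos r i ⊆ activeBefore m n pos (r + 1) i := by
      intro k
      have := k.2
      simp only [mem_activeBefore]
      omega
    have e2 : activeBefore m n pos (r + 1) i ⊆ insert ⟨r + 1, h1⟩ (activeBefore m n pos r i) := by
      intro k
      simp only [mem_activeBefore, Finset.mem_insert, Fin.ext_iff]
      omega
    have c1 := Finset.card_le_card e1
    have c2 := (Finset.card_le_card e2).trans (Finset.card_insert_le _ _)
    unfold pathRow
    rw [if_neg (by omega), if_neg (by omega)]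
    omega
  rcases lt_or_ge r m with h2 | h2
  · have e : activeBefore m n pos (r + 1) i = activeBefore m n pos r i := by
      ext k
      have := k.2
      simp only [mem_activeBefore]
      omega
    have := hd r
    unfold pathRow
    rw [e]
    split_ifs <;> omega
  · have h3 : m + n - 2 - r < n - 1 := by omega
    have e1 : activeBefore m n pos (r + 1) i ⊆ activeBefore m n pos r i := by
      intro k
      have := k.2
      simp only [mem_activeBefore]
      omega
    have e2 : activeBefore m n pos r i ⊆
        insert ⟨m + n - 2 - r, h3⟩ (activeBefore m n pos (r + 1) i) := by
      intro k
      simp only [mem_activeBefore, Finset.mem_insert, Fin.ext_iff]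
      omega
    have c1 := Finset.card_le_card e1
    have c2 := (Finset.card_le_card e2).trans (Finset.card_insert_le _ _)
    unfold pathRow
    rw [if_neg (by omega), if_neg (by omega)]
    omega

theorem pathRow_mono (hmn : n ≤ m) (hd : ∀ r, n - 1 ≤ r → r + 1 < m → d (r + 1) ≤ d r)
    {r' : ℕ} (hrr : r ≤ r') (hi : i ∈ activeLong m n r) (hi' : i ∈ activeLong m n r') :
    pathRow m n pos d r i ≤ pathRow m n pos d r' i ∧
      pathRow m n pos d r' i + r ≤ pathRow m n pos d r i + r' := by
  induction r', hrr using Nat.le_induction with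
  | base => simp
  | succ k hk ih =>
    have hik : i ∈ activeLong m n k := by
      rw [mem_activeLong] at hi hi' ⊢
      omega
    have h1 := ih hik
    have h2 := pathRow_succ (pos := pos) hmn hd (r := k) (i := i)
    omega

/-- Rank `n - 2` has exactly `n - 1` elements and meets all long chains, so the permutation can be
read off there. -/
theorem pathRow_base (hn : 2 ≤ n) (hmn : n ≤ m) (pos : Equiv.Perm (Fin (n - 1))) :
    pathRow m n (fun i => (pos i).val) d (n - 2) i = (pos i).val := by
  have e : activeBefore m n (fun i => (pos i).val) (n - 2) i
      = (Finset.univ.filter fun k => k < pos i).map pos.symm.toEmbedding := by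
    ext k
    have := k.2
    simp only [mem_activeBefore, Finset.mem_map_equiv, Finset.mem_filter, Finset.mem_univ,
      true_and, Equiv.symm_symm, Fin.lt_def]
    omega
  unfold pathRow
  rw [if_neg (by omega), e, Finset.card_map]
  have : (Finset.univ.filter fun k => k < pos i) = Finset.Iio (pos i) := by ext; simp
  rw [this, Fin.card_Iio]
  omega

end pathRow

/-! ### Configurations built from a permutation, a word and rows -/

/-- The rank of an element of a product of two finite chains. -/
def gridRank {m n : ℕ} (p : Fin m × Fin n) : ℕ := p.1.val + p.2.val

theorem gridRank_ext {m n : ℕ} {p q : Fin m × Fin n} (h : gridRank p = gridRank q)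
    (h2 : p.2.val = q.2.val) : p = q := by
  unfold gridRank at h
  ext <;> omega

theorem exists_gridRank {m n r y : ℕ} (h1 : y ≤ r) (h2 : r < m + y) (h3 : y < n) :
    ∃ p : Fin m × Fin n, gridRank p = r ∧ p.2.val = y :=
  ⟨(⟨r - y, by omega⟩, ⟨y, h3⟩), by simp [gridRank]; omega, rfl⟩

/-- Sequences of pairwise disjoint chains in a product of chains, with `n - 1` long chains of sizes
`m + n - 1, m + n - 3, …`, and short chains of the given sizes. -/
structure IsLongShortChains {m n : ℕ} {ι : Type*} (μ : ι → ℕ)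
    (C : Fin (n - 1) ⊕ ι → Finset (Fin m × Fin n)) : Prop where
  isChain : ∀ k, IsChain (· ≤ ·) (C k : Set (Fin m × Fin n))
  disjoint : ∀ k l, k ≠ l → Disjoint (C k) (C l)
  card_long : ∀ i, (C (Sum.inl i)).card + 2 * i.val + 1 = m + n
  card_short : ∀ k, (C (Sum.inr k)).card = μ k

/-- The row of the element of rank `r` which is not in a long chain. -/
def shortRow {m n : ℕ} {ι : Type*} (w : Fin (m - n + 1) → ι) (f : ι → Fin n) (r : ℕ) : ℕ :=
  -- Values outside `n - 1 ≤ r < m` are junk: `pathRow` does not depend on `d` there.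
  if h : r - (n - 1) < m - n + 1 then (f (w ⟨r - (n - 1), h⟩)).val else 0

theorem shortRow_add {m n : ℕ} {ι : Type*} (w : Fin (m - n + 1) → ι) (f : ι → Fin n)
    (t : Fin (m - n + 1)) : shortRow w f (n - 1 + t.val) = (f (w t)).val := by
  have := t.2
  simp only [shortRow, Nat.add_sub_cancel_left, dif_pos this]

theorem shortRow_succ_le {m n : ℕ} {ι : Type*} {w : Fin (m - n + 1) → ι} {f : ι → Fin n}
    (hmn : n ≤ m) (h : Antitone (f ∘ w)) (r : ℕ) (h1 : n - 1 ≤ r) (h2 : r + 1 < m) :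
    shortRow w f (r + 1) ≤ shortRow w f r := by
  unfold shortRow
  rw [dif_pos (by omega), dif_pos (by omega)]
  exact h (a := ⟨r - (n - 1), by omega⟩) (b := ⟨r + 1 - (n - 1), by omega⟩)
    (by rw [Fin.mk_le_mk]; omega)

open Classical in
/-- The chains determined by an order of the long chains, the indices `w` of the short chains along
the ranks, and the rows `f` of the short chains. -/
noncomputable def chainsOf {m n : ℕ} {ι : Type*} (pos : Equiv.Perm (Fin (n - 1)))
    (w : Fin (m - n + 1) → ι) (f : ι → Fin n) : Fin (n - 1) ⊕ ι → Finset (Fin m × Fin n)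
  | Sum.inl i => Finset.univ.filter fun p => i ∈ activeLong m n (gridRank p) ∧
      pathRow m n (fun i => (pos i).val) (shortRow w f) (gridRank p) i = p.2.val
  | Sum.inr k => Finset.univ.filter fun p =>
      ∃ t : Fin (m - n + 1), gridRank p = n - 1 + t.val ∧ w t = k ∧ p.2 = f k

section chainsOf

variable {m n : ℕ} {ι : Type*} {pos : Equiv.Perm (Fin (n - 1))} {w : Fin (m - n + 1) → ι}
  {f : ι → Fin n}

theorem mem_chainsOf_inl {i : Fin (n - 1)} {p : Fin m × Fin n} :
    p ∈ chainsOf pos w f (Sum.inl i) ↔ i ∈ activeLong m n (gridRank p) ∧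
      pathRow m n (fun i => (pos i).val) (shortRow w f) (gridRank p) i = p.2.val := by
  simp [chainsOf]

theorem mem_chainsOf_inr {k : ι} {p : Fin m × Fin n} :
    p ∈ chainsOf pos w f (Sum.inr k) ↔
      ∃ t : Fin (m - n + 1), gridRank p = n - 1 + t.val ∧ w t = k ∧ p.2 = f k := by
  simp [chainsOf]

theorem card_chainsOf_inl (hmn : n ≤ m) (i : Fin (n - 1)) :
    (chainsOf pos w f (Sum.inl i)).card + 2 * i.val + 1 = m + n := by
  have hi := i.2
  have hinj : Set.InjOn gridRank (chainsOf pos w f (Sum.inl i) : Set (Fin m × Fin n)) := by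
    intro p hp q hq h
    rw [Finset.mem_coe, mem_chainsOf_inl] at hp hq
    exact gridRank_ext h (by rw [← hp.2, ← hq.2, h])
  have himg : (chainsOf pos w f (Sum.inl i)).image gridRank = Finset.Icc i.val (m + n - 2 - i) := by
    ext r
    simp only [Finset.mem_image, mem_chainsOf_inl, Finset.mem_Icc]
    constructor
    · rintro ⟨p, ⟨hp, -⟩, rfl⟩
      rw [mem_activeLong] at hp
      omega
    · intro hr
      have ha : i ∈ activeLong m n r := by rw [mem_activeLong]; omega
      obtain ⟨h1, h2, h3⟩ := pathRow_bounds (pos := fun i => (pos i).val) (d := shortRow w f) hmn ha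
      obtain ⟨p, hp, hp2⟩ := exists_gridRank h1 h2 h3
      exact ⟨p, ⟨by rwa [hp], by rw [hp, hp2]⟩, hp⟩
  rw [← Finset.card_image_of_injOn hinj, himg, Nat.card_Icc]
  omega

theorem isLongShortChains_chainsOf (hn : 1 ≤ n) (hmn : n ≤ m) [DecidableEq ι] {μ : ι → ℕ}
    (hw : ∀ k, (Finset.univ.filter fun t => w t = k).card = μ k) (hf : Antitone (f ∘ w)) :
    IsLongShortChains μ (chainsOf pos w f) where
  isChain := by
    rintro (i | k)
    · have key : ∀ p ∈ chainsOf pos w f (Sum.inl i), ∀ q ∈ chainsOf pos w f (Sum.inl i),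
          gridRank p ≤ gridRank q → p ≤ q := by
        intro p hp q hq h
        rw [mem_chainsOf_inl] at hp hq
        have := pathRow_mono (pos := fun i => (pos i).val) hmn (shortRow_succ_le hmn hf) h hp.1 hq.1
        rw [hp.2, hq.2] at this
        unfold gridRank at this
        exact Prod.mk_le_mk.2 ⟨by rw [Fin.le_def]; omega, by rw [Fin.le_def]; omega⟩
      intro p hp q hq _
      exact (le_total (gridRank p) (gridRank q)).imp (key p hp q hq) (key q hq p hp)
    · intro p hp q hq _
      rw [Finset.mem_coe, mem_chainsOf_inr] at hp hq
      obtain ⟨-, -, -, hp⟩ := hp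
      obtain ⟨-, -, -, hq⟩ := hq
      have h2 : p.2 = q.2 := hp.trans hq.symm
      exact (le_total p.1 q.1).imp (fun h => Prod.mk_le_mk.2 ⟨h, h2.le⟩)
        (fun h => Prod.mk_le_mk.2 ⟨h, h2.ge⟩)
  disjoint := by
    have key : ∀ i k, Disjoint (chainsOf pos w f (Sum.inl i)) (chainsOf pos w f (Sum.inr k)) := by
      intro i k
      rw [Finset.disjoint_left]
      intro p hp hq
      rw [mem_chainsOf_inl] at hp
      rw [mem_chainsOf_inr] at hq
      obtain ⟨t, h1, h2, h3⟩ := hq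
      have h4 := t.2
      apply pathRow_ne (d := shortRow w f) (pos := fun i => (pos i).val) (i := i)
        (r := gridRank p) (m := m) (n := n) (by omega) (by omega)
      rw [hp.2, h1, shortRow_add, h2, h3]
    rintro (i | k) (j | l) hne
    · rw [Finset.disjoint_left]
      intro p hp hq
      rw [mem_chainsOf_inl] at hp hq
      exact hne (congrArg _ (pathRow_injOn (Fin.val_injective.comp pos.injective) hp.1 hq.1
        (hp.2.trans hq.2.symm)))
    · exact key _ _
    · exact (key _ _).symm
    · rw [Finset.disjoint_left]
      intro p hp hq
      rw [mem_chainsOf_inr] at hp hq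
      obtain ⟨t, h1, h2, -⟩ := hp
      obtain ⟨u, h3, h4, -⟩ := hq
      have : t = u := by ext; omega
      subst this
      exact hne (congrArg _ (h2.symm.trans h4))
  card_long := card_chainsOf_inl hmn
  card_short := by
    intro k
    rw [← hw k]
    symm
    have hex : ∀ t : Fin (m - n + 1), ∃ p : Fin m × Fin n,
        gridRank p = n - 1 + t.val ∧ p.2 = f (w t) := by
      intro t
      have h1 := (f (w t)).2
      have h2 := t.2
      obtain ⟨p, hp, hp2⟩ := exists_gridRank (m := m) (n := n) (r := n - 1 + t.val)
        (y := f (w t)) (by omega) (by omega) h1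
      exact ⟨p, hp, Fin.ext hp2⟩
    choose g hg1 hg2 using hex
    apply Finset.card_bij (fun t _ => g t)
    · intro t ht
      rw [Finset.mem_filter] at ht
      rw [mem_chainsOf_inr]
      exact ⟨t, hg1 t, ht.2, by rw [hg2, ht.2]⟩
    · intro t _ u _ h
      have h1 := hg1 t
      have h2 := hg1 u
      rw [h] at h1
      ext
      omega
    · intro p hp
      rw [mem_chainsOf_inr] at hp
      obtain ⟨t, h1, h2, h3⟩ := hp
      refine ⟨t, by simp [h2], gridRank_ext ((hg1 t).trans h1.symm) ?_⟩
      rw [hg2, h2, h3]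

/-- The free elements give `w` and the values `f (w t)`, so surjectivity of `w` is what recovers all
of `f`; rank `n - 2` gives `pos`. -/
theorem chainsOf_inj (hn : 1 ≤ n) (hmn : n ≤ m) {pos' : Equiv.Perm (Fin (n - 1))}
    {w' : Fin (m - n + 1) → ι} {f' : ι → Fin n} (hw : Function.Surjective w)
    (h : chainsOf pos w f = chainsOf pos' w' f') : pos = pos' ∧ w = w' ∧ f = f' := by
  have key : ∀ t, w t = w' t ∧ f (w t) = f' (w t) := by
    intro t
    have h1 := (f (w t)).2
    have h2 := t.2
    obtain ⟨p, hp, hp2⟩ := exists_gridRank (m := m) (n := n) (r := n - 1 + t.val)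
      (y := f (w t)) (by omega) (by omega) h1
    have hm : p ∈ chainsOf pos w f (Sum.inr (w t)) := mem_chainsOf_inr.2 ⟨t, hp, rfl, Fin.ext hp2⟩
    rw [h, mem_chainsOf_inr] at hm
    obtain ⟨u, hu1, hu2, hu3⟩ := hm
    have : t = u := by ext; omega
    subst this
    exact ⟨hu2.symm, by rw [← hu3]; exact (Fin.ext hp2).symm⟩
  refine ⟨?_, funext fun t => (key t).1, ?_⟩
  · ext i
    have hi := i.2
    have ha : i ∈ activeLong m n (n - 2) := by rw [mem_activeLong]; omega
    obtain ⟨h1, h2, h3⟩ := pathRow_bounds (pos := fun i => (pos i).val) (d := shortRow w f) hmn ha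
    obtain ⟨p, hp, hp2⟩ := exists_gridRank h1 h2 h3
    have hm : p ∈ chainsOf pos w f (Sum.inl i) :=
      mem_chainsOf_inl.2 ⟨by rwa [hp], by rw [hp, hp2]⟩
    rw [h, mem_chainsOf_inl, hp, hp2, pathRow_base (by omega) hmn, pathRow_base (by omega) hmn]
      at hm
    exact hm.2.symm
  · ext k
    obtain ⟨t, rfl⟩ := hw k
    rw [(key t).2]

end chainsOf

/-! ### Structure of an arbitrary configuration -/

theorem sum_univ_odd (N : ℕ) : ∑ i : Fin N, (2 * i.val + 1) = N * N := by
  induction N with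
  | zero => simp
  | succ N ih =>
    rw [Fin.sum_univ_castSucc]
    simp only [Fin.val_castSucc, ih, Fin.val_last]
    ring

theorem sum_long_add (m n : ℕ) (hn : 1 ≤ n) (hmn : n ≤ m) (c : Fin (n - 1) → ℕ)
    (hc : ∀ i, c i + 2 * i.val + 1 = m + n) : ∑ i, c i + (m - n + 1) = m * n := by
  have h : ∑ i, (c i + (2 * i.val + 1)) = (n - 1) * (m + n) := by
    simp [← add_assoc, hc]
  rw [Finset.sum_add_distrib, sum_univ_odd] at h
  obtain ⟨k, rfl⟩ := Nat.exists_eq_add_of_le hn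
  obtain ⟨l, rfl⟩ := Nat.exists_eq_add_of_le hmn
  simp only [Nat.add_sub_cancel_left] at h ⊢
  nlinarith

namespace IsLongShortChains

variable {m n : ℕ} {ι : Type*} {μ : ι → ℕ} {C : Fin (n - 1) ⊕ ι → Finset (Fin m × Fin n)}

theorem le_of_rank_le (hC : IsLongShortChains μ C) {k : Fin (n - 1) ⊕ ι} {p q : Fin m × Fin n}
    (hp : p ∈ C k) (hq : q ∈ C k) (h : gridRank p ≤ gridRank q) : p ≤ q := by
  by_cases e : p = q
  · exact e.le
  rcases hC.isChain k hp hq e with h1 | h1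
  · exact h1
  · have h2 := Fin.le_def.1 (Prod.mk_le_mk.1 h1).1
    have h3 := Fin.le_def.1 (Prod.mk_le_mk.1 h1).2
    unfold gridRank at h
    exact (e (Prod.ext (by omega) (by omega))).elim

theorem eq_of_rank_eq (hC : IsLongShortChains μ C) {k : Fin (n - 1) ⊕ ι} {p q : Fin m × Fin n}
    (hp : p ∈ C k) (hq : q ∈ C k) (h : gridRank p = gridRank q) : p = q :=
  le_antisymm (hC.le_of_rank_le hp hq h.le) (hC.le_of_rank_le hq hp h.ge)

theorem row_of_rank_succ (hC : IsLongShortChains μ C) {k : Fin (n - 1) ⊕ ι} {p q : Fin m × Fin n}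
    (hp : p ∈ C k) (hq : q ∈ C k) (h : gridRank q = gridRank p + 1) :
    p.2.val ≤ q.2.val ∧ q.2.val ≤ p.2.val + 1 := by
  have h1 := hC.le_of_rank_le hp hq (by omega)
  have h2 := Fin.le_def.1 (Prod.mk_le_mk.1 h1).1
  have h3 := Fin.le_def.1 (Prod.mk_le_mk.1 h1).2
  unfold gridRank at h
  omega

theorem index_eq (hC : IsLongShortChains μ C) {k l : Fin (n - 1) ⊕ ι} {p : Fin m × Fin n}
    (hp : p ∈ C k) (hq : p ∈ C l) : k = l := by
  by_contra h
  exact Finset.disjoint_left.1 (hC.disjoint k l h) hp hq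

/-- Covering is not part of `IsLongShortChains`: it follows from disjointness, since the sizes add
up to `m * n`. -/
theorem exists_mem (hC : IsLongShortChains μ C) [Fintype ι] (hn : 1 ≤ n) (hmn : n ≤ m)
    (hμ : ∑ k, μ k = m - n + 1) (p : Fin m × Fin n) : ∃ k, p ∈ C k := by
  classical
  have h : (Finset.univ.biUnion C).card = Fintype.card (Fin m × Fin n) := by
    rw [Finset.card_biUnion (fun k _ l _ h => hC.disjoint k l h), Fintype.sum_sum_type,
      Fintype.card_prod, Fintype.card_fin, Fintype.card_fin,
      ← sum_long_add m n hn hmn _ hC.card_long, ← hμ]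
    simp [hC.card_short]
  have := Finset.mem_univ p
  rw [← (Finset.card_eq_iff_eq_univ _).1 h, Finset.mem_biUnion] at this
  obtain ⟨k, -, hk⟩ := this
  exact ⟨k, hk⟩

/-- The chains that meet a rank are at most as many as the elements of that rank. -/
theorem card_le_of_forall_exists_rank (hC : IsLongShortChains μ C) {r : ℕ}
    {K : Finset (Fin (n - 1) ⊕ ι)} (hK : ∀ k ∈ K, ∃ p ∈ C k, gridRank p = r) :
    K.card ≤ min r (n - 1) + 1 - (r + 1 - m) := by
  rcases K.eq_empty_or_nonempty with rfl | ⟨k, hk⟩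
  · simp
  obtain ⟨p, -⟩ := hK k hk
  have : Nonempty (Fin m × Fin n) := ⟨p⟩
  choose! e he1 he2 using hK
  -- The bound counts the rows from `r + 1 - m` to `min r (n - 1)`; a chain is sent to the row where
  -- it meets the rank.
  rw [← Nat.card_Icc]
  apply Finset.card_le_card_of_injOn (fun k => (e k).2.val)
  · intro k hk
    have h1 := he2 k hk
    have h2 := (e k).1.2
    have h3 := (e k).2.2
    unfold gridRank at h1
    simp only [Finset.coe_Icc, Set.mem_Icc]
    omega
  · intro k hk l hl h
    have h1 := gridRank_ext ((he2 k hk).trans (he2 l hl).symm) h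
    have h2 := he1 l hl
    rw [← h1] at h2
    exact hC.index_eq (he1 k hk) h2

/-- A rank outside the window of chain `a` is already filled by chains of smaller index, by
induction. The window has as many ranks as the chain has elements, so all of them are met. -/
theorem image_rank_long (hC : IsLongShortChains μ C) (i : Fin (n - 1)) :
    (C (Sum.inl i)).image gridRank = Finset.Icc i.val (m + n - 2 - i) := by
  classical
  obtain ⟨a, ha⟩ := i
  induction a using Nat.strong_induction_on with
  | _ a ih =>
  apply Finset.eq_of_subset_of_card_le
  · intro r hr
    rw [Finset.mem_image] at hr
    obtain ⟨p, hp, rfl⟩ := hr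
    by_contra hcon
    simp only [Finset.mem_Icc, not_and_or, not_le] at hcon
    have hp1 := p.1.2
    have hp2 := p.2.2
    have hpr : gridRank p = p.1.val + p.2.val := rfl
    have hsub : ∀ j ∈ activeLong m n (gridRank p), j.val < a := by
      intro j hj
      rw [mem_activeLong] at hj
      omega
    have hle := hC.card_le_of_forall_exists_rank (r := gridRank p)
      (K := insert (Sum.inl ⟨a, ha⟩) ((activeLong m n (gridRank p)).image Sum.inl)) (by
        intro k hk
        rw [Finset.mem_insert, Finset.mem_image] at hk
        rcases hk with rfl | ⟨j, hj, rfl⟩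
        · exact ⟨p, hp, rfl⟩
        · have h1 := ih j.val (hsub j hj) j.2
          have h2 : gridRank p ∈ Finset.Icc j.val (m + n - 2 - j) := by
            rw [mem_activeLong] at hj
            rw [Finset.mem_Icc]
            omega
          rw [← h1, Finset.mem_image] at h2
          exact h2)
    rw [Finset.card_insert_of_notMem, Finset.card_image_of_injective _ Sum.inl_injective,
      card_activeLong] at hle
    · omega
    · simp only [Finset.mem_image, Sum.inl.injEq, exists_eq_right]
      intro h
      exact absurd (hsub _ h) (lt_irrefl _)
  · rw [Finset.card_image_of_injOn fun p hp q hq h => hC.eq_of_rank_eq hp hq h, Nat.card_Icc]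
    have := hC.card_long ⟨a, ha⟩
    simp only at this ⊢
    omega

theorem exists_long (hC : IsLongShortChains μ C) {i : Fin (n - 1)} {r : ℕ}
    (h : i ∈ activeLong m n r) : ∃ p ∈ C (Sum.inl i), gridRank p = r := by
  rw [← Finset.mem_image, hC.image_rank_long, Finset.mem_Icc]
  rw [mem_activeLong] at h
  omega

theorem mem_activeLong_of_mem (hC : IsLongShortChains μ C) {i : Fin (n - 1)} {p : Fin m × Fin n}
    (hp : p ∈ C (Sum.inl i)) : i ∈ activeLong m n (gridRank p) := by
  have h := Finset.mem_image_of_mem gridRank hp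
  rw [hC.image_rank_long, Finset.mem_Icc] at h
  have := i.2
  rw [mem_activeLong]
  have hp1 := p.1.2
  omega

theorem card_short_add_card_activeLong_le (hC : IsLongShortChains μ C) {r : ℕ} {K : Finset ι}
    (hK : ∀ k ∈ K, ∃ p ∈ C (Sum.inr k), gridRank p = r) :
    (activeLong m n r).card + K.card ≤ min r (n - 1) + 1 - (r + 1 - m) := by
  rw [← Finset.card_disjSum]
  apply hC.card_le_of_forall_exists_rank
  rintro (i | k) h
  · rw [Finset.inl_mem_disjSum] at h
    exact hC.exists_long h
  · rw [Finset.inr_mem_disjSum] at h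
    exact hK k h

/-- In every other rank the long chains use all the elements. -/
theorem rank_short (hC : IsLongShortChains μ C) {k : ι} {p : Fin m × Fin n}
    (hp : p ∈ C (Sum.inr k)) : n - 1 ≤ gridRank p ∧ gridRank p < m := by
  have h := hC.card_short_add_card_activeLong_le (r := gridRank p) (K := {k}) (by
    intro l hl
    rw [Finset.mem_singleton] at hl
    subst hl
    exact ⟨p, hp, rfl⟩)
  rw [Finset.card_singleton, card_activeLong] at h
  have hp1 := p.1.2
  have hp2 := p.2.2
  have hpr : gridRank p = p.1.val + p.2.val := rfl
  omega

theorem short_index_eq (hC : IsLongShortChains μ C) {k l : ι} {p q : Fin m × Fin n}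
    (hp : p ∈ C (Sum.inr k)) (hq : q ∈ C (Sum.inr l)) (hpq : gridRank p = gridRank q) :
    k = l := by
  classical
  by_contra hne
  have h := hC.card_short_add_card_activeLong_le (r := gridRank p) (K := {k, l}) (by
    intro a ha
    rw [Finset.mem_insert, Finset.mem_singleton] at ha
    rcases ha with rfl | rfl
    · exact ⟨p, hp, rfl⟩
    · exact ⟨q, hq, hpq.symm⟩)
  rw [Finset.card_pair hne, card_activeLong] at h
  have := hC.rank_short hp
  omega

theorem short_eq (hC : IsLongShortChains μ C) {k l : ι} {p q : Fin m × Fin n}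
    (hp : p ∈ C (Sum.inr k)) (hq : q ∈ C (Sum.inr l)) (hpq : gridRank p = gridRank q) :
    p = q := by
  have := hC.short_index_eq hp hq hpq
  subst this
  exact hC.eq_of_rank_eq hp hq hpq

theorem exists_short (hC : IsLongShortChains μ C) [Fintype ι] (hn : 1 ≤ n) (hmn : n ≤ m)
    (hμ : ∑ k, μ k = m - n + 1) (t : Fin (m - n + 1)) :
    ∃ k, ∃ p ∈ C (Sum.inr k), gridRank p = n - 1 + t := by
  classical
  set U := Finset.univ.biUnion fun k => C (Sum.inr k) with hU
  have hcard : U.card = m - n + 1 := by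
    rw [hU, Finset.card_biUnion fun k _ l _ h => hC.disjoint _ _ (Sum.inr_injective.ne h), ← hμ]
    simp [hC.card_short]
  have himg : U.image gridRank = Finset.Ico (n - 1) m := by
    apply Finset.eq_of_subset_of_card_le
    · intro r hr
      simp only [hU, Finset.mem_image, Finset.mem_biUnion, Finset.mem_univ, true_and] at hr
      obtain ⟨p, ⟨k, hk⟩, rfl⟩ := hr
      exact Finset.mem_Ico.2 (hC.rank_short hk)
    · rw [Finset.card_image_of_injOn, hcard, Nat.card_Ico]
      · omega
      · intro p hp q hq h
        simp only [hU, Finset.mem_coe, Finset.mem_biUnion, Finset.mem_univ, true_and] at hp hq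
        obtain ⟨k, hk⟩ := hp
        obtain ⟨l, hl⟩ := hq
        exact hC.short_eq hk hl h
  have ht : n - 1 + t.val ∈ U.image gridRank := by
    rw [himg, Finset.mem_Ico]
    omega
  simp only [hU, Finset.mem_image, Finset.mem_biUnion, Finset.mem_univ, true_and] at ht
  obtain ⟨p, ⟨k, hk⟩, h⟩ := ht
  exact ⟨k, p, hk, h⟩

/-- The rows of the elements of short chains weakly decrease along the ranks. -/
theorem short_row_le (hC : IsLongShortChains μ C) [Fintype ι] (hn : 1 ≤ n) (hmn : n ≤ m)
    (hμ : ∑ k, μ k = m - n + 1) {k l : ι} {p q : Fin m × Fin n}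
    (hp : p ∈ C (Sum.inr k)) (hq : q ∈ C (Sum.inr l)) (h : gridRank q = gridRank p + 1) :
    q.2.val ≤ p.2.val := by
  by_contra hlt
  have hp1 := hC.rank_short hp
  have hq1 := hC.rank_short hq
  have hpn := p.2.2
  -- If the row went up, all rows `0, …, p.2` of the next rank would lie on long chains. Each of
  -- these comes from a row no higher and different from `p.2`, so `p.2 + 1` long chains would
  -- inject into `p.2` rows.
  have hex : ∀ y ∈ Finset.range (p.2.val + 1), ∃ x : Fin m × Fin n, ∃ z : Fin m × Fin n,
      ∃ i, x ∈ C (Sum.inl i) ∧ z ∈ C (Sum.inl i) ∧ gridRank x = gridRank p ∧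
        gridRank z = gridRank p + 1 ∧ x.2.val < p.2.val ∧ z.2.val = y := by
    intro y hy
    rw [Finset.mem_range] at hy
    obtain ⟨z, hz, hzy⟩ := exists_gridRank (m := m) (n := n) (r := gridRank p + 1) (y := y)
      (by omega) (by omega) (by omega)
    obtain ⟨i | k', hi⟩ := hC.exists_mem hn hmn hμ z
    · have ha : i ∈ activeLong m n (gridRank p) := by
        have := i.2
        rw [mem_activeLong]
        omega
      obtain ⟨x, hx, hxr⟩ := hC.exists_long ha
      refine ⟨x, z, i, hx, hi, hxr, hz, ?_, hzy⟩
      have h1 := hC.row_of_rank_succ hx hi (by omega)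
      have h2 : x.2.val ≠ p.2.val := by
        intro e
        rw [gridRank_ext hxr e] at hx
        exact absurd (hC.index_eq hx hp) (by simp)
      omega
    · have := hC.short_eq hi hq (by omega)
      subst this
      omega
  have : Nonempty (Fin m × Fin n) := ⟨p⟩
  have : Nonempty (Fin (n - 1)) :=
    let ⟨_, _, i, _⟩ := hex 0 (by simp)
    ⟨i⟩
  choose! x z i hx hz hxr hzr hxy hzy using hex
  have hcard := Finset.card_le_card_of_injOn (s := Finset.range (p.2.val + 1))
    (t := Finset.range p.2.val) (fun y => (x y).2.val)
    (fun y hy => by simpa using hxy y hy) (by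
      intro y hy y' hy' e
      have h1 := gridRank_ext ((hxr y hy).trans (hxr y' hy').symm) e
      have h2 := hx y hy
      rw [h1] at h2
      have h3 := hC.index_eq h2 (hx y' hy')
      have h4 := hz y hy
      rw [h3] at h4
      have h5 := hC.eq_of_rank_eq h4 (hz y' hy') ((hzr y hy).trans (hzr y' hy').symm)
      rw [← hzy y hy, ← hzy y' hy', h5])
  simp at hcard

/-- The long chains do not cross. -/
theorem long_row_lt (hC : IsLongShortChains μ C) {i j : Fin (n - 1)} {r r' : ℕ} (hr : r ≤ r')
    {p q p' q' : Fin m × Fin n} (hp : p ∈ C (Sum.inl i)) (hq : q ∈ C (Sum.inl j))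
    (hp' : p' ∈ C (Sum.inl i)) (hq' : q' ∈ C (Sum.inl j)) (hpr : gridRank p = r)
    (hqr : gridRank q = r) (hpr' : gridRank p' = r') (hqr' : gridRank q' = r')
    (h : p.2.val < q.2.val) : p'.2.val < q'.2.val := by
  induction r', hr using Nat.le_induction generalizing p' q' with
  | base =>
    rw [← hC.eq_of_rank_eq hp hp' (by omega), ← hC.eq_of_rank_eq hq hq' (by omega)]
    exact h
  | succ s hs ih =>
    have ai := hC.mem_activeLong_of_mem hp
    have aj := hC.mem_activeLong_of_mem hq
    have ai' := hC.mem_activeLong_of_mem hp'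
    have aj' := hC.mem_activeLong_of_mem hq'
    rw [mem_activeLong] at ai aj ai' aj'
    obtain ⟨u, hu, hur⟩ := hC.exists_long (i := i) (r := s) (by rw [mem_activeLong]; omega)
    obtain ⟨v, hv, hvr⟩ := hC.exists_long (i := j) (r := s) (by rw [mem_activeLong]; omega)
    have h1 := ih hu hv hur hvr
    have h2 := hC.row_of_rank_succ hu hp' (by omega)
    have h3 := hC.row_of_rank_succ hv hq' (by omega)
    -- A row rises by 0 or 1 per rank, so the order could only be lost by the two chains meeting.
    have h4 : p'.2.val ≠ q'.2.val := by
      intro e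
      rw [gridRank_ext (by omega) e] at hp'
      have h5 := Sum.inl_injective (hC.index_eq hp' hq')
      subst h5
      rw [hC.eq_of_rank_eq hu hv (by omega)] at h1
      omega
    omega

/-- The rows at rank `n - 2` define the permutation; non-crossing carries their order to every other
rank, by contradiction for lower ranks. -/
theorem exists_perm (hC : IsLongShortChains μ C) (hmn : n ≤ m) :
    ∃ pos : Equiv.Perm (Fin (n - 1)), ∀ {i j : Fin (n - 1)} {p q : Fin m × Fin n},
      p ∈ C (Sum.inl i) → q ∈ C (Sum.inl j) → gridRank p = gridRank q →
        ((pos i).val < (pos j).val ↔ p.2.val < q.2.val) := by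
  have hex : ∀ i : Fin (n - 1), ∃ p ∈ C (Sum.inl i), gridRank p = n - 2 := by
    intro i
    have := i.2
    exact hC.exists_long (by rw [mem_activeLong]; omega)
  choose B hB hBr using hex
  have hinj : Function.Injective fun i : Fin (n - 1) => (⟨(B i).2.val, by
      have h1 := hBr i
      have := i.2
      unfold gridRank at h1
      omega⟩ : Fin (n - 1)) := by
    intro i j h
    have h1 := gridRank_ext ((hBr i).trans (hBr j).symm) (Fin.mk.inj_iff.1 h)
    have h2 := hB i
    rw [h1] at h2
    exact Sum.inl_injective (hC.index_eq h2 (hB j))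
  refine ⟨Equiv.ofBijective _ (Finite.injective_iff_bijective.1 hinj), ?_⟩
  intro i j p q hp hq hpq
  simp only [Equiv.ofBijective_apply]
  have down : ∀ {i j : Fin (n - 1)} {p q : Fin m × Fin n},
      p ∈ C (Sum.inl i) → q ∈ C (Sum.inl j) → gridRank p = gridRank q →
        (B i).2.val < (B j).2.val → p.2.val < q.2.val := by
    intro i j p q hp hq hpq h
    rcases le_total (gridRank p) (n - 2) with hr | hr
    · by_contra hcon
      rcases Nat.lt_or_eq_of_le (not_lt.1 hcon) with h1 | h1
      · have := hC.long_row_lt hr hq hp (hB j) (hB i) hpq.symm rfl (hBr j) (hBr i) h1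
        omega
      · rw [gridRank_ext hpq h1.symm] at hp
        have h5 := Sum.inl_injective (hC.index_eq hp hq)
        subst h5
        omega
    · exact hC.long_row_lt hr (hB i) (hB j) hp hq (hBr i) (hBr j) rfl hpq.symm h
  refine ⟨down hp hq hpq, fun h => ?_⟩
  by_contra hcon
  rcases Nat.lt_or_eq_of_le (not_lt.1 hcon) with h1 | h1
  · have := down hq hp hpq.symm h1
    omega
  · have h2 := hinj (a₁ := j) (a₂ := i) (Fin.ext h1)
    subst h2
    rw [hC.eq_of_rank_eq hp hq hpq] at h
    omega

theorem exists_eq_chainsOf (hC : IsLongShortChains μ C) [Fintype ι] [DecidableEq ι] (hn : 1 ≤ n)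
    (hmn : n ≤ m) (hμ : ∑ k, μ k = m - n + 1) (hpos : ∀ k, 0 < μ k) :
    ∃ (pos : Equiv.Perm (Fin (n - 1))) (w : Fin (m - n + 1) → ι) (f : ι → Fin n),
      (∀ k, (Finset.univ.filter fun t => w t = k).card = μ k) ∧ Antitone (f ∘ w) ∧
        chainsOf pos w f = C := by
  obtain ⟨pos, hσ⟩ := hC.exists_perm hmn
  choose w P hP hPr using hC.exists_short hn hmn hμ
  have hmono : Antitone fun t => (P t).2 := by
    rw [Fin.antitone_iff_succ_le]
    intro t
    apply hC.short_row_le hn hmn hμ (hP _) (hP _)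
    rw [hPr, hPr]
    simp [add_assoc]
  have hshort : ∀ {k p}, p ∈ C (Sum.inr k) → ∃ t, gridRank p = n - 1 + t.val ∧ w t = k ∧ P t = p := by
    intro k p hp
    have h := hC.rank_short hp
    have h1 : gridRank (P ⟨gridRank p - (n - 1), by omega⟩) = gridRank p := by
      rw [hPr]
      simp only
      omega
    exact ⟨⟨gridRank p - (n - 1), by omega⟩, by simp only; omega,
      hC.short_index_eq (hP _) hp h1, hC.short_eq (hP _) hp h1⟩
  -- Rows weakly increase along a chain but weakly decrease along free elements, hence are constant
  -- on a short chain.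
  have hrow : ∀ {k p q}, p ∈ C (Sum.inr k) → q ∈ C (Sum.inr k) → p.2 = q.2 := by
    have key : ∀ {k p q}, p ∈ C (Sum.inr k) → q ∈ C (Sum.inr k) → gridRank p ≤ gridRank q →
        p.2 = q.2 := by
      intro k p q hp hq h
      apply le_antisymm (Prod.mk_le_mk.1 (hC.le_of_rank_le hp hq h)).2
      obtain ⟨t, ht, -, rfl⟩ := hshort hp
      obtain ⟨u, hu, -, rfl⟩ := hshort hq
      exact hmono (by rw [Fin.le_def]; omega)
    intro k p q hp hq
    rcases le_total (gridRank p) (gridRank q) with h | h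
    · exact key hp hq h
    · exact (key hq hp h).symm
  have hne : ∀ k, ∃ p, p ∈ C (Sum.inr k) := fun k =>
    Finset.card_pos.1 (by rw [hC.card_short]; exact hpos k)
  choose F hF using hne
  have hfw : ∀ t, (F (w t)).2 = (P t).2 := fun t => hrow (hF _) (hP t)
  have hanti : Antitone ((fun k => (F k).2) ∘ w) := by
    intro t u htu
    simp only [Function.comp, hfw]
    exact hmono htu
  have hd : ∀ t : Fin (m - n + 1),
      shortRow w (fun k => (F k).2) (n - 1 + t.val) = (P t).2.val := by
    intro t
    rw [shortRow_add, hfw]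
  have hcount : ∀ k, (Finset.univ.filter fun t => w t = k).card = μ k := by
    intro k
    rw [← hC.card_short k]
    apply Finset.card_bij (fun t _ => P t)
    · intro t ht
      rw [Finset.mem_filter] at ht
      rw [← ht.2]
      exact hP t
    · intro t _ u _ h
      have h1 := hPr t
      rw [h, hPr] at h1
      ext
      omega
    · intro p hp
      obtain ⟨t, -, h1, h2⟩ := hshort hp
      exact ⟨t, by simp [h1], h2⟩
  refine ⟨pos, w, fun k => (F k).2, hcount, hanti, ?_⟩
  have hval := isLongShortChains_chainsOf (pos := pos) hn hmn hcount hanti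
  symm
  funext κ
  rcases κ with i | k
  · apply Finset.eq_of_subset_of_card_le
    swap
    · have h1 := hval.card_long i
      have h2 := hC.card_long i
      omega
    intro p hp
    rw [mem_chainsOf_inl]
    refine ⟨hC.mem_activeLong_of_mem hp, ?_⟩
    set d := shortRow w fun k => (F k).2
    set r := gridRank p with hr
    have hpr : r = p.1.val + p.2.val := rfl
    have hp1 := p.1.2
    have hp2 := p.2.2
    have hin := i.2
    -- The implication sits under `∃ y` so that `choose` gives a total function `g`: the row of
    -- chain `j` at rank `r`.
    have hex : ∀ j, ∃ y, j ∈ activeBefore m n (fun i => (pos i).val) r i →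
        ∃ q ∈ C (Sum.inl j), gridRank q = r ∧ q.2.val = y ∧ y < p.2.val := by
      intro j
      by_cases hj : j ∈ activeBefore m n (fun i => (pos i).val) r i
      · rw [mem_activeBefore] at hj
        obtain ⟨q, hq, hqr⟩ := hC.exists_long (i := j) (r := r) (by rw [mem_activeLong]; exact hj.1)
        exact ⟨q.2.val, fun _ => ⟨q, hq, hqr, rfl, (hσ hq hp hqr).1 hj.2⟩⟩
      · exact ⟨0, fun h => (hj h).elim⟩
    choose g hg using hex
    have hginj : Set.InjOn g (activeBefore m n (fun i => (pos i).val) r i) := by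
      intro j hj j' hj' h
      obtain ⟨q, hq, hqr, hqy, -⟩ := hg j hj
      obtain ⟨q', hq', hqr', hqy', -⟩ := hg j' hj'
      rw [gridRank_ext (hqr.trans hqr'.symm) (by omega)] at hq
      exact Sum.inl_injective (hC.index_eq hq hq')
    have hcard := Finset.card_image_of_injOn hginj
    -- The rows of rank `r` below `p` are those of the preceding long chains, plus possibly that of
    -- the free element. Counting them yields the formula of `pathRow`.
    have key1 : ∀ y, r + 1 - m ≤ y → y < p.2.val →
        y ∈ (activeBefore m n (fun i => (pos i).val) r i).image g ∨
          (n - 1 ≤ r ∧ r < m ∧ y = d r) := by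
      intro y hy1 hy2
      obtain ⟨q, hqr, hqy⟩ := exists_gridRank (m := m) (n := n) (r := r) (y := y)
        (by omega) (by omega) (by omega)
      obtain ⟨j | k, hq⟩ := hC.exists_mem hn hmn hμ q
      · left
        have hj : j ∈ activeBefore m n (fun i => (pos i).val) r i := by
          rw [mem_activeBefore, ← mem_activeLong, ← hqr]
          exact ⟨hC.mem_activeLong_of_mem hq, (hσ hq hp hqr).2 (by omega)⟩
        obtain ⟨q', hq', hqr', hqy', -⟩ := hg j hj
        rw [Finset.mem_image]
        refine ⟨j, hj, ?_⟩
        rw [← hqy', ← hqy, hC.eq_of_rank_eq hq hq' (by omega)]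
      · right
        have h1 := hC.rank_short hq
        obtain ⟨t, ht, -, rfl⟩ := hshort hq
        refine ⟨by omega, by omega, ?_⟩
        rw [← hqr, ht, ← hqy]
        exact (hd t).symm
    have key2 : ∀ y ∈ (activeBefore m n (fun i => (pos i).val) r i).image g,
        r + 1 - m ≤ y ∧ y < p.2.val := by
      intro y hy
      obtain ⟨j, hj, rfl⟩ := Finset.mem_image.1 hy
      obtain ⟨q, hq, hqr, hqy, hlt⟩ := hg j hj
      have := q.1.2
      unfold gridRank at hqr
      omega
    have key3 : n - 1 ≤ r → r < m → ∀ {j q}, q ∈ C (Sum.inl j) → gridRank q = r →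
        q.2.val ≠ d r := by
      intro h1 h2 j q hq hqr h
      have e := hd ⟨r - (n - 1), by omega⟩
      have e2 := hPr ⟨r - (n - 1), by omega⟩
      have h3 : n - 1 + (r - (n - 1)) = r := by omega
      simp only [h3] at e e2
      rw [gridRank_ext (hqr.trans e2.symm) (h.trans e)] at hq
      exact absurd (hC.index_eq hq (hP _)) (by simp)
    by_cases hcen : n - 1 ≤ r ∧ r < m ∧ d r < p.2.val
    · have hI : Finset.Ico (r + 1 - m) p.2.val =
          insert (d r) ((activeBefore m n (fun i => (pos i).val) r i).image g) := by
        ext y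
        rw [Finset.mem_Ico, Finset.mem_insert]
        constructor
        · rintro ⟨h1, h2⟩
          exact (key1 y h1 h2).symm.imp (fun h => h.2.2) id
        · rintro (rfl | h)
          · omega
          · exact key2 y h
      have h1 := congrArg Finset.card hI
      rw [Finset.card_insert_of_notMem, hcard, Nat.card_Ico] at h1
      · unfold pathRow
        rw [if_pos (by omega)]
        omega
      · intro h
        obtain ⟨j, hj, e⟩ := Finset.mem_image.1 h
        obtain ⟨q, hq, hqr, hqy, -⟩ := hg j hj
        exact key3 hcen.1 hcen.2.1 hq hqr (hqy.trans e)
    · have hI : Finset.Ico (r + 1 - m) p.2.val =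
          ((activeBefore m n (fun i => (pos i).val) r i).image g) := by
        ext y
        rw [Finset.mem_Ico]
        constructor
        · rintro ⟨h1, h2⟩
          rcases key1 y h1 h2 with h | h
          · exact h
          · omega
        · exact key2 y
      have h1 := congrArg Finset.card hI
      rw [hcard, Nat.card_Ico] at h1
      unfold pathRow
      by_cases hc : n - 1 ≤ r ∧ r < m
      · have h3 := key3 hc.1 hc.2 hp rfl
        rw [if_neg (by omega)]
        omega
      · rw [if_neg (by omega)]
        omega
  · apply Finset.eq_of_subset_of_card_le
    swap
    · rw [hval.card_short, hC.card_short]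
    intro p hp
    obtain ⟨t, ht, htk, rfl⟩ := hshort hp
    exact mem_chainsOf_inr.2 ⟨t, ht, htk, hrow hp (hF k)⟩

end IsLongShortChains

/-! ### Counting functions with prescribed fibers -/

/-- The number of elements that a function maps to a given value. -/
def fiberCard {X κ : Type*} [Fintype X] [DecidableEq κ] (w : X → κ) (k : κ) : ℕ :=
  (Finset.univ.filter fun x => w x = k).card

theorem fiberCard_comp_perm {X κ : Type*} [Fintype X] [DecidableEq κ]
    (w : X → κ) (σ : Equiv.Perm X) :
    fiberCard (w ∘ σ) = fiberCard w := by
  funext k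
  exact Finset.card_equiv σ (by simp)

theorem exists_perm_comp_eq {X κ : Type*} [Fintype X] [DecidableEq κ]
    {w v : X → κ} (h : fiberCard w = fiberCard v) :
    ∃ τ : Equiv.Perm X, w ∘ τ = v := by
  have e : ∀ k, Nonempty ({x // v x = k} ≃ {x // w x = k}) := fun k =>
    Fintype.card_eq.1 (by
      rw [Fintype.card_subtype, Fintype.card_subtype]
      exact (congrFun h k).symm)
  exact ⟨Equiv.ofFiberEquiv fun k => (e k).some, funext fun x => Equiv.ofFiberEquiv_map _ x⟩

theorem exists_fiberCard_eq {X κ : Type*} [Fintype X] [Fintype κ] [DecidableEq κ]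
    (μ : κ → ℕ) (h : ∑ k, μ k = Fintype.card X) :
    ∃ w : X → κ, fiberCard w = μ := by
  have e : Nonempty (X ≃ Σ k, Fin (μ k)) := Fintype.card_eq.1 (by simp [h])
  obtain ⟨e⟩ := e
  refine ⟨fun x => (e x).1, funext fun k => ?_⟩
  unfold fiberCard
  rw [← Fintype.card_subtype, ← Fintype.card_fin (μ k)]
  exact Fintype.card_congr ((e.subtypeEquiv fun _ => Iff.rfl).trans
    (Equiv.sigmaSubtype (β := fun k => Fin (μ k)) k))

section fiberCard

variable {X κ : Type*} [Fintype X] [DecidableEq X] [Fintype κ] [DecidableEq κ]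

theorem card_perm_comp_eq_self (w : X → κ) :
    (Finset.univ.filter fun σ : Equiv.Perm X => w ∘ σ = w).card = ∏ k, (fiberCard w k).factorial := by
  rw [← Fintype.card_subtype, DomMulAct.stabilizer_card]
  simp only [Fintype.card_subtype, fiberCard]

/-- The solutions form a coset of the stabilizer of `w`. -/
theorem card_perm_comp_eq {w v : X → κ} (h : fiberCard w = fiberCard v) :
    (Finset.univ.filter fun σ : Equiv.Perm X => w ∘ σ = v).card
      = ∏ k, (fiberCard w k).factorial := by
  obtain ⟨τ, rfl⟩ := exists_perm_comp_eq h
  rw [← card_perm_comp_eq_self]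
  refine Finset.card_equiv (Equiv.mulRight τ⁻¹) fun σ => ?_
  simp only [Finset.mem_filter, Finset.mem_univ, true_and, Equiv.coe_mulRight]
  constructor
  · intro h
    funext x
    simpa using congrFun h (τ⁻¹ x)
  · intro h
    funext x
    simpa using congrFun h (τ x)

/-- Double counting along `σ ↦ w ∘ σ`, whose fibers all have size `∏ k, (fiberCard w k)!`. -/
theorem card_fiberCard_eq_mul (w : X → κ) (P : (X → κ) → Prop) [DecidablePred P] :
    (Finset.univ.filter fun v : X → κ => fiberCard v = fiberCard w ∧ P v).card *
      ∏ k, (fiberCard w k).factorial =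
      (Finset.univ.filter fun σ : Equiv.Perm X => P (w ∘ σ)).card := by
  rw [Finset.card_eq_sum_card_fiberwise (f := fun σ : Equiv.Perm X => w ∘ σ)
    (t := Finset.univ.filter fun v : X → κ => fiberCard v = fiberCard w ∧ P v)]
  · rw [← smul_eq_mul, ← Finset.sum_const]
    refine Finset.sum_congr rfl fun v hv => ?_
    rw [Finset.mem_filter] at hv
    rw [← card_perm_comp_eq hv.2.1.symm, Finset.filter_filter]
    congr 1
    ext σ
    simp only [Finset.mem_filter, Finset.mem_univ, true_and, iff_and_self]
    rintro rfl
    exact hv.2.2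
  · intro σ hσ
    simpa [fiberCard_comp_perm] using hσ

/-- A multinomial coefficient counts functions with given fiber sizes. -/
theorem card_fiberCard_eq (a : κ → ℕ) (h : ∑ k, a k = Fintype.card X) :
    (Finset.univ.filter fun v : X → κ => fiberCard v = a).card
      = Nat.multinomial Finset.univ a := by
  obtain ⟨w, rfl⟩ := exists_fiberCard_eq (X := X) a h
  have h1 := card_fiberCard_eq_mul w fun _ => True
  have h2 := Nat.multinomial_spec Finset.univ (fiberCard w)
  rw [h, mul_comm] at h2
  simp only [and_true, Finset.filter_true, Finset.card_univ, Fintype.card_perm] at h1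
  exact Nat.eq_of_mul_eq_mul_right (Finset.prod_pos fun k _ => Nat.factorial_pos _)
    (h1.trans h2.symm)

end fiberCard

/-- `g` has a unique antitone rearrangement, so again a coset of its stabilizer is counted. -/
theorem card_perm_antitone_comp {N n : ℕ} (g : Fin N → Fin n) :
    (Finset.univ.filter fun σ : Equiv.Perm (Fin N) => Antitone (g ∘ σ)).card
      = ∏ j, (fiberCard g j).factorial := by
  set τ : Equiv.Perm (Fin N) := Fin.revPerm.trans (Tuple.sort g) with hτ
  have hanti : Antitone (g ∘ τ) := fun a b hab =>
    Tuple.monotone_sort g (Fin.rev_le_rev.2 hab)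
  rw [← card_perm_comp_eq (fiberCard_comp_perm g τ).symm]
  congr 1
  ext σ
  simp only [Finset.mem_filter, Finset.mem_univ, true_and]
  exact ⟨fun h => Tuple.unique_antitone h hanti, fun h => h ▸ hanti⟩

theorem fiberCard_comp {X ι κ : Type*} [Fintype X] [Fintype ι] [DecidableEq ι] [DecidableEq κ]
    (w : X → ι) (f : ι → κ) (j : κ) :
    fiberCard (f ∘ w) j = ∑ k with f k = j, fiberCard w k := by
  unfold fiberCard
  rw [Finset.card_eq_sum_card_fiberwise (f := w) (t := Finset.univ.filter fun k => f k = j)]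
  · refine Finset.sum_congr rfl fun k hk => ?_
    rw [Finset.filter_filter]
    congr 1
    ext x
    simp only [Finset.mem_filter, Finset.mem_univ, true_and] at hk ⊢
    constructor
    · exact fun h => h.2
    · rintro rfl
      exact ⟨hk, rfl⟩
  · intro x hx
    simpa using hx

theorem card_antitone_comp_mul {N n : ℕ} {ι : Type*} [Fintype ι] [DecidableEq ι] (μ : ι → ℕ)
    (hμ : ∑ k, μ k = N) (f : ι → Fin n) :
    (Finset.univ.filter fun w : Fin N → ι => fiberCard w = μ ∧ Antitone (f ∘ w)).card *
      ∏ k, (μ k).factorial = ∏ j, (∑ k with f k = j, μ k).factorial := by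
  obtain ⟨w, rfl⟩ := exists_fiberCard_eq (X := Fin N) μ (by simpa using hμ)
  rw [card_fiberCard_eq_mul w fun v => Antitone (f ∘ v)]
  simp only [← fiberCard_comp]
  exact card_perm_antitone_comp (f ∘ w)

/-- The numbers of elements with values `k` and `j` under two functions. -/
def jointCard {ι κ : Type*} [Fintype ι] [DecidableEq κ] {n : ℕ} (c : ι → κ) (f : ι → Fin n)
    (k : κ) (j : Fin n) : ℕ :=
  (Finset.univ.filter fun i => c i = k ∧ f i = j).card

/-- The choice of `f` splits into independent choices on the fibers of `c`. -/
theorem card_jointCard_eq {ι κ : Type*} [Fintype ι] [DecidableEq ι] [Fintype κ] [DecidableEq κ]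
    {n : ℕ} (c : ι → κ) (a : κ → Fin n → ℕ) (ha : ∀ k, ∑ j, a k j = fiberCard c k) :
    (Finset.univ.filter fun f : ι → Fin n => jointCard c f = a).card =
      ∏ k, Nat.multinomial Finset.univ (a k) := by
  have h : ∀ k, (Finset.univ.filter fun v : {i // c i = k} → Fin n => fiberCard v = a k).card =
      Nat.multinomial Finset.univ (a k) := fun k =>
    card_fiberCard_eq (a k) (by rw [ha, Fintype.card_subtype]; rfl)
  simp only [← h]
  rw [← Fintype.card_piFinset]
  refine Finset.card_equiv ((Equiv.arrowCongr (Equiv.sigmaFiberEquiv c).symm (Equiv.refl _)).trans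
    (Equiv.piCurry fun _ _ => Fin n)) fun f => ?_
  simp only [Finset.mem_filter, Finset.mem_univ, true_and, Fintype.mem_piFinset, funext_iff]
  refine forall_congr' fun k => forall_congr' fun j => ?_
  rw [iff_iff_eq]
  congr 1
  unfold jointCard fiberCard
  symm
  refine Finset.card_bij (fun i _ => i.val) ?_ ?_ ?_
  · rintro ⟨i, hi⟩ h
    simp only [Finset.mem_filter, Finset.mem_univ, true_and] at h ⊢
    exact ⟨hi, h⟩
  · intro i _ i' _ h
    exact Subtype.ext h
  · intro i hi
    simp only [Finset.mem_filter, Finset.mem_univ, true_and] at hi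
    exact ⟨⟨i, hi.1⟩, by rw [Finset.mem_filter]; exact ⟨Finset.mem_univ _, hi.2⟩, rfl⟩

theorem sum_jointCard {ι κ : Type*} [Fintype ι] [DecidableEq κ] {n : ℕ} (c : ι → κ)
    (f : ι → Fin n) (k : κ) : ∑ j, jointCard c f k j = fiberCard c k := by
  unfold jointCard fiberCard
  rw [Finset.card_eq_sum_card_fiberwise (f := f) (t := Finset.univ) fun _ _ => Finset.mem_univ _]
  simp only [Finset.filter_filter]

theorem sum_mul_jointCard {ι κ : Type*} [Fintype ι] [Fintype κ] [DecidableEq κ] {n : ℕ}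
    (c : ι → κ) (f : ι → Fin n) (s : κ → ℕ) (j : Fin n) :
    ∑ k, s k * jointCard c f k j = ∑ i with f i = j, s (c i) := by
  rw [← Finset.sum_fiberwise_of_maps_to (g := c) (t := Finset.univ) fun _ _ => Finset.mem_univ _]
  refine Finset.sum_congr rfl fun k _ => ?_
  rw [Finset.filter_filter, jointCard, mul_comm, ← smul_eq_mul, ← Finset.sum_const]
  refine Finset.sum_congr (by ext; simp [and_comm]) fun i hi => ?_
  rw [(Finset.mem_filter.1 hi).2.2]

/-- The summand depends on `f` only through `jointCard c f`, so the sum is grouped by that array. -/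
theorem sum_card_antitone_comp {N M n : ℕ} {ι : Type*} [Fintype ι] [DecidableEq ι] (c : ι → Fin M)
    (hμ : ∑ i, ((c i).val + 1) = N) :
    ∑ f : ι → Fin n, ((Finset.univ.filter fun w : Fin N → ι =>
        (fiberCard w = fun i => (c i).val + 1) ∧ Antitone (f ∘ w)).card : ℚ) =
      ∑ a ∈ Fintype.piFinset fun k : Fin M =>
            Finset.piAntidiag (Finset.univ : Finset (Fin n)) (fiberCard c k),
          (∏ j : Fin n, ((∑ k : Fin M, ((k : ℕ) + 1) * a k j).factorial : ℚ)) *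
            ∏ k : Fin M, (Nat.multinomial Finset.univ (a k) : ℚ) *
                (1 / (((k : ℕ) + 1).factorial : ℚ)) ^ fiberCard c k := by
  have hprod : ∏ k : Fin M, (1 / (((k : ℕ) + 1).factorial : ℚ)) ^ fiberCard c k
      = 1 / ∏ i, (((c i).val + 1).factorial : ℚ) := by
    rw [← Finset.prod_fiberwise_of_maps_to (g := c) (t := Finset.univ)
      (fun _ _ => Finset.mem_univ _), one_div, ← Finset.prod_inv_distrib]
    refine Finset.prod_congr rfl fun k _ => ?_
    rw [one_div, inv_pow, fiberCard, ← Finset.prod_const]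
    congr 1
    refine Finset.prod_congr rfl fun i hi => ?_
    rw [(Finset.mem_filter.1 hi).2]
  rw [← Finset.sum_fiberwise_of_maps_to (g := jointCard c) (s := Finset.univ) (t :=
    Fintype.piFinset fun k : Fin M =>
      Finset.piAntidiag (Finset.univ : Finset (Fin n)) (fiberCard c k))]
  · refine Finset.sum_congr rfl fun a ha => ?_
    simp only [Fintype.mem_piFinset, Finset.mem_piAntidiag] at ha
    rw [Finset.prod_mul_distrib, hprod, ← Nat.cast_prod (f := fun k => Nat.multinomial _ (a k)),
      ← card_jointCard_eq c a fun k => (ha k).1]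
    have hconst : ∀ f ∈ Finset.univ.filter fun f : ι → Fin n => jointCard c f = a,
        ((Finset.univ.filter fun w : Fin N → ι =>
          (fiberCard w = fun i => (c i).val + 1) ∧ Antitone (f ∘ w)).card : ℚ) =
        (∏ j : Fin n, ((∑ k : Fin M, ((k : ℕ) + 1) * a k j).factorial : ℚ)) *
          (1 / ∏ i, (((c i).val + 1).factorial : ℚ)) := by
      intro f hf
      have hfa := (Finset.mem_filter.1 hf).2
      subst hfa
      have h := card_antitone_comp_mul (fun i => (c i).val + 1) hμ f
      rw [mul_one_div, eq_div_iff (Finset.prod_ne_zero_iff.2 fun i _ =>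
        Nat.cast_ne_zero.2 (Nat.factorial_ne_zero _))]
      simp only [sum_mul_jointCard c f fun k => k.val + 1]
      exact_mod_cast h
    rw [Finset.sum_congr rfl hconst, Finset.sum_const, nsmul_eq_mul]
    ring
  · intro f _
    rw [Fintype.mem_piFinset]
    intro k
    rw [Finset.mem_piAntidiag]
    exact ⟨sum_jointCard c f k, fun _ _ => Finset.mem_univ _⟩

/-! ### From configurations to the formula -/

theorem ncard_isLongShortChains {m n : ℕ} (hn : 1 ≤ n) (hmn : n ≤ m) {ι : Type*} [Fintype ι]
    [DecidableEq ι] {μ : ι → ℕ} (hμ : ∑ k, μ k = m - n + 1) (hpos : ∀ k, 0 < μ k) :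
    {C : Fin (n - 1) ⊕ ι → Finset (Fin m × Fin n) | IsLongShortChains μ C}.ncard =
      (n - 1).factorial * ∑ f : ι → Fin n, (Finset.univ.filter fun w : Fin (m - n + 1) → ι =>
        fiberCard w = μ ∧ Antitone (f ∘ w)).card := by
  set T : Finset (Equiv.Perm (Fin (n - 1)) × Σ _ : ι → Fin n, Fin (m - n + 1) → ι) :=
    Finset.univ ×ˢ Finset.univ.sigma fun f => Finset.univ.filter fun w : Fin (m - n + 1) → ι =>
        fiberCard w = μ ∧ Antitone (f ∘ w) with hT
  have hmem : ∀ x, x ∈ T ↔ fiberCard x.2.2 = μ ∧ Antitone (x.2.1 ∘ x.2.2) := by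
    intro x
    simp [hT]
  have hset : {C : Fin (n - 1) ⊕ ι → Finset (Fin m × Fin n) | IsLongShortChains μ C} =
      (fun x : Equiv.Perm (Fin (n - 1)) × Σ _ : ι → Fin n, Fin (m - n + 1) → ι =>
        chainsOf x.1 x.2.2 x.2.1) '' T := by
    ext C
    simp only [Set.mem_ofPred_eq, Set.mem_image, Finset.mem_coe, hmem]
    constructor
    · intro hC
      obtain ⟨pos, w, f, hw, hf, h⟩ := hC.exists_eq_chainsOf hn hmn hμ hpos
      exact ⟨⟨pos, f, w⟩, ⟨funext hw, hf⟩, h⟩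
    · rintro ⟨x, hx, rfl⟩
      exact isLongShortChains_chainsOf hn hmn (congrFun hx.1) hx.2
  rw [hset, Set.InjOn.ncard_image, Set.ncard_coe_finset, hT, Finset.card_product,
    Finset.card_univ, Fintype.card_perm, Fintype.card_fin, Finset.card_sigma]
  rintro ⟨pos, f, w⟩ hx ⟨pos', f', w'⟩ _ h
  rw [Finset.mem_coe, hmem] at hx
  have hw : Function.Surjective w := by
    intro k
    have h1 := congrFun hx.1 k
    have h2 := hpos k
    rw [← h1, fiberCard, Finset.card_pos] at h2
    obtain ⟨t, ht⟩ := h2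
    exact ⟨t, (Finset.mem_filter.1 ht).2⟩
  obtain ⟨rfl, rfl, rfl⟩ := chainsOf_inj hn hmn hw h
  rfl

theorem partList_pos {N : ℕ} (lam : N.Partition) (i : Fin (partList lam).length) :
    0 < (partList lam).get i := by
  apply lam.parts_pos
  rw [← Multiset.mem_sort (r := (· ≥ ·))]
  exact List.get_mem _ i

theorem sum_partList {N : ℕ} (lam : N.Partition) : (partList lam).sum = N := by
  rw [← Multiset.sum_coe, partList, Multiset.sort_eq, lam.parts_sum]

theorem antitone_partList {N : ℕ} (lam : N.Partition) : Antitone (partList lam).get :=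
  (Multiset.pairwise_sort lam.parts (· ≥ ·)).sortedGE.antitone_get

theorem count_ofFn {N : ℕ} (g : Fin N → ℕ) (a : ℕ) : (List.ofFn g).count a = fiberCard g a := by
  rw [← Multiset.coe_count, ← Fin.univ_val_map, Multiset.count_map, fiberCard, Finset.card,
    Finset.filter_val]
  simp only [eq_comm]

theorem mainTheorem5 (m n : ℕ) (hn : 1 ≤ n) (hmn : n ≤ m) (lam : (m * n).Partition)
    (hlam : ∀ i : ℕ, 1 ≤ i → i ≤ n - 1 → (partList lam)[i - 1]? = some (m + n - 2 * i + 1))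
    (α : ℕ → ℕ) (hα : ∀ k, α k = (truncatedParts lam n).count k) :
    ((SCP (Fin m × Fin n) lam).ncard : ℚ) =
      ((n - 1).factorial : ℚ) *
        ∑ a ∈ Fintype.piFinset fun k : Fin (m - n + 1) =>
            Finset.piAntidiag (Finset.univ : Finset (Fin n)) (α (k + 1)),
          (∏ j : Fin n, ((∑ k : Fin (m - n + 1), ((k : ℕ) + 1) * a k j).factorial : ℚ)) *
            ∏ k : Fin (m - n + 1),
              (Nat.multinomial Finset.univ (a k) : ℚ) *
                (1 / (((k : ℕ) + 1).factorial : ℚ)) ^ α (k + 1) := by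
  set L := partList lam with hL
  have hlen : n - 1 ≤ L.length := by
    by_contra h
    have h1 := hlam (n - 1) (by omega) le_rfl
    rw [List.getElem?_eq_none (by omega)] at h1
    exact absurd h1 (by simp)
  set s := L.length - (n - 1) with hs
  set e : Fin (n - 1) ⊕ Fin s ≃ Fin L.length := finSumFinEquiv.trans (finCongr (by omega)) with he
  have he1 : ∀ i, (e (Sum.inl i)).val = i.val := by intro i; simp [he]
  have he2 : ∀ k, (e (Sum.inr k)).val = n - 1 + k.val := by intro k; simp [he]
  set μ : Fin s → ℕ := fun k => L.get (e (Sum.inr k)) with hμdef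
  have hlong : ∀ i, L.get (e (Sum.inl i)) + 2 * i.val + 1 = m + n := by
    intro i
    have hi := i.2
    have h := hlam (i.val + 1) (by omega) (by omega)
    rw [Nat.add_sub_cancel, List.getElem?_eq_getElem (by omega), Option.some.injEq] at h
    have h2 : L.get (e (Sum.inl i)) = L[i.val]'(by omega) := by
      simp only [List.get_eq_getElem, he1]
    rw [h2, h]
    omega
  have hpos : ∀ k, 0 < μ k := fun k => partList_pos lam _
  have hμ : ∑ k, μ k = m - n + 1 := by
    have h1 : ∑ i, L.get i = m * n := by
      rw [← List.sum_ofFn, List.ofFn_get, hL, sum_partList]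
    rw [← e.sum_comp, Fintype.sum_sum_type] at h1
    have h2 := sum_long_add m n hn hmn _ hlong
    exact Nat.add_left_cancel (h1.trans h2.symm)
  have hle : ∀ k, μ k ≤ m - n + 1 := fun k =>
    hμ ▸ Finset.single_le_sum (fun _ _ => Nat.zero_le _) (Finset.mem_univ k)
  -- Size `μ k ∈ {1, …, m - n + 1}` is encoded by the 0-based index `μ k - 1`.
  set c : Fin s → Fin (m - n + 1) := fun k => ⟨μ k - 1, by have := hle k; have := hpos k; omega⟩
    with hc
  have hcμ : ∀ k, (c k).val + 1 = μ k := by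
    intro k
    have := hpos k
    simp only [hc]
    omega
  have hdrop : truncatedParts lam n = List.ofFn μ := by
    apply List.ext_getElem
    · simp [truncatedParts, hs, hL]
    · intro i h1 h2
      simp only [truncatedParts, List.getElem_drop, List.getElem_ofFn, hμdef, List.get_eq_getElem,
        he2, hL]
  have hαc : ∀ k : Fin (m - n + 1), α (k + 1) = fiberCard c k := by
    intro k
    rw [hα, hdrop, count_ofFn, fiberCard, fiberCard]
    congr 1
    ext i
    have := hcμ i
    simp only [Finset.mem_filter, Finset.mem_univ, true_and, Fin.ext_iff]
    omega
  -- Reindexing along `e` loses nothing: nonemptiness, covering and decreasing sizes all follow from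
  -- the prescribed sizes and disjointness.
  have hset : {C : Fin (n - 1) ⊕ Fin s → Finset (Fin m × Fin n) | IsLongShortChains μ C} =
      (fun C => C ∘ e) '' SCP (Fin m × Fin n) lam := by
    ext C
    rw [Set.mem_ofPred_eq, Set.mem_image]
    constructor
    · intro hC
      have hcard : ∀ i, (C (e.symm i)).card = L.get i := by
        intro i
        obtain ⟨k | k, rfl⟩ := e.surjective i
        · have h1 := hC.card_long k
          have h2 := hlong k
          rw [e.symm_apply_apply]
          omega
        · rw [e.symm_apply_apply, hC.card_short]
      refine ⟨C ∘ e.symm, ⟨⟨fun i => ?_, fun i => hC.isChain _, fun i j hij =>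
        hC.disjoint _ _ (e.symm.injective.ne hij), fun x => ?_, ?_⟩, hcard⟩, ?_⟩
      · exact Finset.card_pos.1 ((hcard i).symm ▸ partList_pos lam i)
      · obtain ⟨k, hk⟩ := hC.exists_mem hn hmn hμ x
        exact ⟨e k, by simpa using hk⟩
      · intro i j hij
        simp only [Function.comp, hcard]
        exact antitone_partList lam hij
      · funext k
        simp
    · rintro ⟨C, ⟨hC, hcard⟩, rfl⟩
      refine ⟨fun k => hC.isChain _, fun k l hkl => hC.disjoint _ _ (e.injective.ne hkl),
        fun i => ?_, fun k => hcard _⟩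
      rw [← hlong i]
      simp only [Function.comp, hcard]
      rfl
  have hncard : (SCP (Fin m × Fin n) lam).ncard =
      {C : Fin (n - 1) ⊕ Fin s → Finset (Fin m × Fin n) | IsLongShortChains μ C}.ncard := by
    rw [hset, Set.ncard_image_of_injective _ e.surjective.injective_comp_right]
  rw [hncard, ncard_isLongShortChains hn hmn hμ hpos]
  simp only [hαc]
  rw [← sum_card_antitone_comp c (by simpa only [hcμ] using hμ)]
  simp only [hcμ]
  push_cast
  rfl
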